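/- Let $\mathcal X,\mathcal Y$ be finite or countably infinite sets, let $P_{X_1Y_1},\dots,P_{X_mY_m}$ be probability distributions on $\mathcal X\times\mathcal Y$, and let $\alpha_1,\dots,\alpha_m>0$ with $\sum_i\alpha_i=1$. Let $(\mathbf X,\mathbf Y)=\{(X^n,Y^n)\}_{n\ge1}$ be the mixture of the corresponding i.i.d. sources, i.e. for all $n\ge 1$, $x^n\in\mathcal X^n$, $y^n\in\mathcal Y^n$, $$P_{X^nY^n}(x^n,y^n)=\sum_{i=1}^m\alpha_i\prod_{t=1}^nP_{X_iY_i}(x_t,y_t).$$ Let $H(X_i|Y_i)=\sum_{x,y}P_{X_iY_i}(x,y)\log\frac1{P_{X_i|Y_i}(x|y)}\in[0,\infty]$ (natural logarithm) and assume $H(X_1|Y_1)>H(X_2|Y_2)>\dots>H(X_m|Y_m)$. Put $A_i=\sum_{j=1}^{i-1}\alpha_j$ for $i=1,\dots,m$ and $A_{m+1}=1$. A variable-length code $\Phi$ for $X$ with common side information $Y$ consists, for each $y$, of a stochastic encoder $W_y(c|x)$ (the probability that $x$ is encoded into the finite binary string $c$), whose codebook $\mathcal C_y=\{c:W_y(c|x)>0\text{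 for some }x\}$ is prefix-free, and a decoder $\psi_y:\mathcal C_y\to\mathcal X$. Its error probability and the exponential moment of its codeword length $|c|$ are $$p_e(\Phi|X,Y)=\sum_{x,y}P_{XY}(x,y)\sum_{c\in\mathcal C_y:\,\psi_y(c)\ne x}W_y(c|x),\qquad M_\rho(\Phi|X,Y)=\sum_{x,y}P_{XY}(x,y)\sum_{c\in\mathcal C_y}W_y(c|x)\,e^{\rho|c|\log2}.$$ A real number $E$ is $\varepsilon$-achievable if there are codes $\Phi_n$ for $X^n$ with side information $Y^n$ such that $\limsup_{n\to\infty}p_e(\Phi_n|X^n,Y^n)\le\varepsilon$ and $\limsup_{n\to\infty}\frac1n\log M_\rho(\Phi_n|X^n,Y^n)\le E$; let $E_{\mathrm{sc}}(\rho,\varepsilon|\mathbf X,\mathbf Y)$ be the infimum of the $\varepsilon$-achievable numbers ($+\infty$ if there are none). Then, for all $\rho>0$ and $\varepsilon\in[0,1)$, there is exactly one $i\in\{1,\dots,m\}$ with $\varepsilon\in[A_i,A_{i+1})$, and for this $i$ $$E_{\mathrm{sc}}(\rho,\varepsilon|\mathbf X,\mathbf Y)=\rho\,H(X_i|Y_i).$$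 -/

import Mathlib

open Filter
open scoped ENNReal

namespace MixedSource

/-- The marginal probability `P_Y(y)` of a joint distribution on `𝒳 × 𝒴`. -/
noncomputable def margSnd {𝒳 𝒴 : Type*} (P : PMF (𝒳 × 𝒴)) (y : 𝒴) : ℝ≥0∞ :=
  ∑' x, P (x, y)

/-- The conditional probability `P_{X|Y}(x|y) = P_{XY}(x,y) / P_Y(y)`. -/
noncomputable def condProb {𝒳 𝒴 : Type*} (P : PMF (𝒳 × 𝒴)) (x : 𝒳) (y : 𝒴) : ℝ≥0∞ :=
  P (x, y) / margSnd P y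

/-- The conditional entropy `H(X|Y) = ∑ P_{XY}(x,y) log (1 / P_{X|Y}(x|y))` in nats, as an element
of `[0, ∞]`: all terms are nonnegative, and the sum may diverge on an infinite alphabet. Terms with
`P_{XY}(x,y) = 0` are zero. -/
noncomputable def condEntropy {𝒳 𝒴 : Type*} (P : PMF (𝒳 × 𝒴)) : ℝ≥0∞ :=
  ∑' p : 𝒳 × 𝒴,
    ENNReal.ofReal ((P p).toReal * Real.log (1 / (condProb P p.1 p.2).toReal))

/-- The set of binary strings that a stochastic encoder uses with positive probability. -/
def codebook {𝒳 : Type*} (φ : 𝒳 → PMF (List Bool)) : Set (List Bool) :=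
  {c | ∃ x, c ∈ (φ x).support}

/-- A variable-length binary source code for `X` with common side information `Y`: for every `y` a
stochastic encoder, `enc y x c` being the probability `W_y(c|x)` that `x` is encoded into the string
`c`, and a deterministic decoder on the codebook, which has to be prefix-free. -/
structure Code (𝒳 𝒴 : Type*) where
  enc : 𝒴 → 𝒳 → PMF (List Bool)
  dec : (y : 𝒴) → codebook (enc y) → 𝒳
  isPrefixFree : ∀ y, ∀ c ∈ codebook (enc y), ∀ c' ∈ codebook (enc y), c <+: c' → c = c'

/-- The error probability `p_e = ∑ P_{XY}(x,y) ∑_{c : x ≠ ψ_y(c)} W_y(c|x)`. -/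
noncomputable def Code.errorProb {𝒳 𝒴 : Type*} (C : Code 𝒳 𝒴) (P : PMF (𝒳 × 𝒴)) : ℝ≥0∞ :=
  ∑' p : 𝒳 × 𝒴, P p *
    ∑' c : {c : codebook (C.enc p.2) // p.1 ≠ C.dec p.2 c}, C.enc p.2 p.1 (c.1 : List Bool)

/-- The exponential moment of the codeword length (in nats),
`M_ρ = ∑ P_{XY}(x,y) ∑_c W_y(c|x) exp(ρ |c| log 2)`, as an element of `[0, ∞]`. -/
noncomputable def Code.expMoment {𝒳 𝒴 : Type*} (C : Code 𝒳 𝒴) (ρ : ℝ) (P : PMF (𝒳 × 𝒴)) :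
    ℝ≥0∞ :=
  ∑' p : 𝒳 × 𝒴, P p *
    ∑' c : codebook (C.enc p.2), C.enc p.2 p.1 (c : List Bool) *
      ENNReal.ofReal (Real.exp (ρ * ((c : List Bool).length * Real.log 2)))

/-- A general source: a sequence of joint distributions of `(Xⁿ, Yⁿ)` on `𝒳ⁿ × 𝒴ⁿ`, with no
consistency required between different `n`. (The entry at `n = 0` plays no role.) -/
abbrev GeneralSource (𝒳 𝒴 : Type*) := (n : ℕ) → PMF ((Fin n → 𝒳) × (Fin n → 𝒴))

/-- The general source `P` is the mixture, with weights `α`, of the i.i.d. sources with the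
single-letter distributions `Q i`. -/
structure IsMixture {𝒳 𝒴 : Type*} (P : GeneralSource 𝒳 𝒴) {m : ℕ} (Q : Fin m → PMF (𝒳 × 𝒴))
    (α : Fin m → ℝ) : Prop where
  weight_pos : ∀ i, 0 < α i
  weight_sum : ∑ i, α i = 1
  apply_eq : ∀ n, 1 ≤ n → ∀ (x : Fin n → 𝒳) (y : Fin n → 𝒴),
    P n (x, y) = ∑ i, ENNReal.ofReal (α i) * ∏ t, Q i (x t, y t)

/-- The sum of the first `k` weights. -/
noncomputable def cumWeight {m : ℕ} (α : Fin m → ℝ) (k : ℕ) : ℝ :=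
  ∑ j : Fin m with j.val < k, α j

/-- The real number `R` is an `ε`-achievable exponent: for some sequence of codes,
`limsup p_e(C_n | Xⁿ, Yⁿ) ≤ ε` and `limsup (1/n) log M_ρ(C_n | Xⁿ, Yⁿ) ≤ R`. -/
def IsAchievable {𝒳 𝒴 : Type*} (P : GeneralSource 𝒳 𝒴) (ρ ε R : ℝ) : Prop :=
  ∃ C : (n : ℕ) → Code (Fin n → 𝒳) (Fin n → 𝒴),
    limsup (fun n => (C n).errorProb (P n)) atTop ≤ ENNReal.ofReal ε ∧
    limsup (fun n => ENNReal.log ((C n).expMoment ρ (P n)) / (n : EReal)) atTop ≤ (R : EReal)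

/-- The infimum of the `ε`-achievable exponents, `+∞` if there are none. -/
noncomputable def optExponent {𝒳 𝒴 : Type*} (P : GeneralSource 𝒳 𝒴) (ρ ε : ℝ) : EReal :=
  sInf {E : EReal | ∃ R : ℝ, E = (R : EReal) ∧ IsAchievable P ρ ε R}

end MixedSource

/-!
The blocklength-`n` law of the mixture is the convex combination of the memoryless laws `iid (Q j) n`,
so the error probability and the exponential moment of a code are the same convex combinations of
their values for the components. For each component, the law of large numbers for the information
density `log (1 / P_{X|Y})` says that the conditional probability of the emitted word is
with high probability `exp (-n H(X_j|Y_j))` to first order in the exponent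
(`tendsto_exp_lt_condProb`, `tendsto_condProb_lt_exp`), and smaller than any given exponential if
`H(X_j|Y_j) = ∞`.

*Achievability* (`IsMixture.isAchievable`). For `h > H(X_i|Y_i)`, at most `m exp (n h)` words have
conditional probability at least `exp (-n h)` under some component. Encoding them with a fixed length
of about `n h / log 2` bits gives the exponent `ρ h`, and errors come, in the limit, only from the
components `j < i`, whose entropy may exceed `h` and whose total weight is at most `ε`.

*Converse* (`IsMixture.mul_le_of_isAchievable`). For `h < H(X_i|Y_i)`, there are fewer than
`2 ^ K ≈ exp (n h)` strings shorter than `K ≈ n h / log 2`, which is not enough to decode correctly a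
nonvanishing fraction of any component `j ≤ i`. As these components have total weight greater than
`ε`, correct decoding through codewords of length at least `K` keeps a probability bounded away from
zero, and each such codeword contributes at least `exp (ρ n h)` to the exponential moment
(`one_le_errorProb_add`). Prefix-freeness is not needed for this direction, and `h` may be taken
arbitrarily large if the entropy is infinite.
-/

namespace MixedSource

open MeasureTheory ProbabilityTheory Topology

/-! ### Memoryless extensions -/

lemma tsum_pi_prod {β : Type*} {n : ℕ} (f : Fin n → β → ℝ≥0∞) :
    ∑' x : Fin n → β, ∏ t, f t (x t) = ∏ t, ∑' b, f t b := by
  induction n with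
  | zero => simp
  | succ n ih =>
    rw [← (Fin.consEquiv fun _ => β).tsum_eq, ENNReal.tsum_prod', Fin.prod_univ_succ, ← ih,
      ← ENNReal.tsum_mul_right]
    refine tsum_congr fun b => ?_
    rw [← ENNReal.tsum_mul_left]
    refine tsum_congr fun x => ?_
    simp [Fin.prod_univ_succ]

/-- The law of `n` independent letter pairs with common distribution `Q`, arranged as a pair of
words of length `n`. -/
noncomputable def iid {𝒳 𝒴 : Type*} (Q : PMF (𝒳 × 𝒴)) (n : ℕ) :
    PMF ((Fin n → 𝒳) × (Fin n → 𝒴)) :=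
  ⟨fun p => ∏ t, Q (p.1 t, p.2 t), by
    have h : ∑' p : (Fin n → 𝒳) × (Fin n → 𝒴), ∏ t, Q (p.1 t, p.2 t) = 1 := by
      rw [← (Equiv.arrowProdEquivProdArrow (Fin n) (fun _ => 𝒳) (fun _ => 𝒴)).tsum_eq]
      simpa using tsum_pi_prod fun _ : Fin n => (Q : 𝒳 × 𝒴 → ℝ≥0∞)
    exact h ▸ ENNReal.summable.hasSum⟩

lemma iid_apply {𝒳 𝒴 : Type*} (Q : PMF (𝒳 × 𝒴)) (n : ℕ) (p : (Fin n → 𝒳) × (Fin n → 𝒴)) :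
    iid Q n p = ∏ t, Q (p.1 t, p.2 t) := rfl

lemma tsum_margSnd {𝒳 𝒴 : Type*} (P : PMF (𝒳 × 𝒴)) : ∑' y, margSnd P y = 1 := by
  simp only [margSnd]
  rw [ENNReal.tsum_comm, ← ENNReal.tsum_prod]
  exact P.tsum_coe

lemma margSnd_ne_top {𝒳 𝒴 : Type*} (P : PMF (𝒳 × 𝒴)) (y : 𝒴) : margSnd P y ≠ ∞ :=
  ne_top_of_le_ne_top ENNReal.one_ne_top ((ENNReal.le_tsum y).trans (tsum_margSnd P).le)

lemma condProb_mul_margSnd {𝒳 𝒴 : Type*} (P : PMF (𝒳 × 𝒴)) (x : 𝒳) (y : 𝒴) :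
    condProb P x y * margSnd P y = P (x, y) := by
  by_cases h : margSnd P y = 0
  · have : P (x, y) = 0 := le_antisymm ((ENNReal.le_tsum (f := fun x => P (x, y)) x).trans h.le) bot_le
    simp [h, this]
  · exact ENNReal.div_mul_cancel h (margSnd_ne_top P y)

lemma tsum_condProb_le_one {𝒳 𝒴 : Type*} (P : PMF (𝒳 × 𝒴)) (y : 𝒴) :
    ∑' x, condProb P x y ≤ 1 := by
  simp only [condProb, div_eq_mul_inv]
  rw [ENNReal.tsum_mul_right]
  exact ENNReal.mul_inv_le_one _

lemma condProb_le_one {𝒳 𝒴 : Type*} (P : PMF (𝒳 × 𝒴)) (x : 𝒳) (y : 𝒴) : condProb P x y ≤ 1 :=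
  (ENNReal.le_tsum (f := fun x => condProb P x y) x).trans (tsum_condProb_le_one P y)

lemma condProb_ne_zero {𝒳 𝒴 : Type*} {P : PMF (𝒳 × 𝒴)} {x : 𝒳} {y : 𝒴} (h : P (x, y) ≠ 0) :
    condProb P x y ≠ 0 :=
  ENNReal.div_ne_zero.2 ⟨h, margSnd_ne_top P y⟩

lemma condProb_iid {𝒳 𝒴 : Type*} (Q : PMF (𝒳 × 𝒴)) {n : ℕ} (x : Fin n → 𝒳) (y : Fin n → 𝒴) :
    condProb (iid Q n) x y = ∏ t, condProb Q (x t) (y t) := by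
  have h : margSnd (iid Q n) y = ∏ t, margSnd Q (y t) :=
    tsum_pi_prod fun t b => Q (b, y t)
  simp only [condProb, h, iid_apply, div_eq_mul_inv, Finset.prod_mul_distrib]
  rw [ENNReal.prod_inv_distrib fun i _ j _ _ => Or.inr (margSnd_ne_top Q _)]

/-! ### Information density and the law of large numbers -/

/-- The conditional information density `log (1 / P_{X|Y}(x|y))`. It is set to `0` where the
conditional probability vanishes, which happens only on a null set. -/
noncomputable def infoDensity {𝒳 𝒴 : Type*} (Q : PMF (𝒳 × 𝒴)) (p : 𝒳 × 𝒴) : ℝ :=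
  Real.log (1 / (condProb Q p.1 p.2).toReal)

lemma infoDensity_nonneg {𝒳 𝒴 : Type*} (Q : PMF (𝒳 × 𝒴)) (p : 𝒳 × 𝒴) : 0 ≤ infoDensity Q p := by
  unfold infoDensity
  rw [one_div, Real.log_inv]
  have := Real.log_nonpos ENNReal.toReal_nonneg
    (ENNReal.toReal_le_of_le_ofReal zero_le_one (by simpa using condProb_le_one Q p.1 p.2))
  linarith

lemma condProb_eq_exp {𝒳 𝒴 : Type*} {Q : PMF (𝒳 × 𝒴)} {p : 𝒳 × 𝒴} (h : Q p ≠ 0) :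
    condProb Q p.1 p.2 = ENNReal.ofReal (Real.exp (-infoDensity Q p)) := by
  have h1 : condProb Q p.1 p.2 ≠ ∞ := ne_top_of_le_ne_top ENNReal.one_ne_top (condProb_le_one _ _ _)
  have h0 : condProb Q p.1 p.2 ≠ 0 := condProb_ne_zero h
  rw [infoDensity, one_div, Real.log_inv, neg_neg, Real.exp_log (ENNReal.toReal_pos h0 h1),
    ENNReal.ofReal_toReal h1]

lemma condProb_iid_eq_exp {𝒳 𝒴 : Type*} {Q : PMF (𝒳 × 𝒴)} {n : ℕ}
    {p : (Fin n → 𝒳) × (Fin n → 𝒴)} (h : iid Q n p ≠ 0) :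
    condProb (iid Q n) p.1 p.2 =
      ENNReal.ofReal (Real.exp (-∑ t, infoDensity Q (p.1 t, p.2 t))) := by
  rw [iid_apply, Finset.prod_ne_zero_iff] at h
  rw [condProb_iid, ← Finset.sum_neg_distrib, Real.exp_sum,
    ENNReal.ofReal_prod_of_nonneg fun _ _ => (Real.exp_pos _).le]
  exact Finset.prod_congr rfl fun t _ => condProb_eq_exp (h t (Finset.mem_univ t))

/-- The weak law of large numbers, as a bound on the lower tail, for the memoryless extensions of a
distribution on a countable alphabet. -/
lemma tendsto_iid_sum_le {𝒳 𝒴 : Type*} [Countable 𝒳] [Countable 𝒴]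
    [MeasurableSpace 𝒳] [MeasurableSpace 𝒴] [DiscreteMeasurableSpace 𝒳]
    [DiscreteMeasurableSpace 𝒴] (Q : PMF (𝒳 × 𝒴)) (f : 𝒳 × 𝒴 → ℝ)
    (hf : Integrable f Q.toMeasure) {a : ℝ} (ha : a < ∫ p, f p ∂Q.toMeasure) :
    Tendsto (fun n : ℕ => (iid Q n).toOuterMeasure {p | ∑ t, f (p.1 t, p.2 t) ≤ n * a})
      atTop (𝓝 0) := by
  set μ : Measure (ℕ → 𝒳 × 𝒴) := Measure.infinitePi fun _ => Q.toMeasure with hμ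
  have hmf : Measurable f := measurable_of_countable f
  -- The first `n` coordinates of the infinite product have law `iid Q n`.
  have law (n : ℕ) (s : Set ((Fin n → 𝒳) × (Fin n → 𝒴))) : (iid Q n).toOuterMeasure s =
      μ ((fun ω => (fun t : Fin n => (ω t).1, fun t : Fin n => (ω t).2)) ⁻¹' s) := by
    set X : (ℕ → 𝒳 × 𝒴) → (Fin n → 𝒳) × (Fin n → 𝒴) :=
      fun ω => (fun t : Fin n => (ω t).1, fun t : Fin n => (ω t).2) with hX
    have hXm : Measurable X := by fun_prop
    rw [← Measure.map_apply hXm (Set.to_countable s).measurableSet,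
      ← Measure.tsum_indicator_apply_singleton _ s (Set.to_countable s).measurableSet,
      PMF.toOuterMeasure_apply]
    congr 1
    ext p
    congr 1
    ext p
    rw [Measure.map_apply hXm (measurableSet_singleton p)]
    have : X ⁻¹' {p} = Set.pi (Finset.range n : Set ℕ)
        (fun i => if h : i < n then {(p.1 ⟨i, h⟩, p.2 ⟨i, h⟩)} else Set.univ) := by
      ext ω
      simp only [Set.mem_preimage, Set.mem_singleton_iff, Set.mem_pi, Finset.coe_range,
        Set.mem_Iio, hX]
      constructor
      · rintro rfl i hi
        simp [hi]
      · intro h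
        refine Prod.ext ?_ ?_ <;> funext t <;> have := h t t.2 <;> simp at this <;> simp [this]
    rw [this, hμ, Measure.infinitePi_pi _ fun i _ => (Set.to_countable _).measurableSet,
      ← Fin.prod_univ_eq_prod_range, iid_apply]
    refine Finset.prod_congr rfl fun t _ => ?_
    simp [PMF.toMeasure_apply_singleton]
  have hid (i : ℕ) : μ.map (fun ω => ω i) = Q.toMeasure := Measure.infinitePi_map_eval _ i
  have hint : Integrable (fun ω => f (ω 0)) μ := by
    rw [← hid 0] at hf
    exact hf.comp_measurable (measurable_pi_apply 0)
  have hmean : ∫ ω, f (ω 0) ∂μ = ∫ p, f p ∂Q.toMeasure := by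
    rw [← hid 0, integral_map (measurable_pi_apply 0).aemeasurable hmf.aestronglyMeasurable]
  have hind : iIndepFun (fun i (ω : ℕ → 𝒳 × 𝒴) => f (ω i)) μ :=
    iIndepFun_infinitePi fun _ => hmf
  have hident (i : ℕ) : IdentDistrib (fun ω : ℕ → 𝒳 × 𝒴 => f (ω i)) (fun ω => f (ω 0)) μ μ :=
    (IdentDistrib.mk (measurable_pi_apply i).aemeasurable (measurable_pi_apply 0).aemeasurable
      (by rw [hid, hid])).comp hmf
  have slln := strong_law_ae (μ := μ) (fun i ω => f (ω i)) hint
    (fun i j hij => hind.indepFun hij) hident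
  have wlln := tendstoInMeasure_of_tendsto_ae (fun n => by
    refine Measurable.aestronglyMeasurable ?_
    fun_prop) slln
  rw [hmean] at wlln
  -- On the event in question the empirical mean is at distance at least `∫ f - a` from the mean.
  have hε : 0 < (∫ p, f p ∂Q.toMeasure) - a := sub_pos.2 ha
  refine tendsto_of_tendsto_of_tendsto_of_le_of_le' tendsto_const_nhds
    (wlln (ENNReal.ofReal ((∫ p, f p ∂Q.toMeasure) - a)) (ENNReal.ofReal_pos.2 hε))
    (Eventually.of_forall fun _ => bot_le) ?_
  filter_upwards [eventually_gt_atTop 0] with n hn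
  rw [law]
  refine measure_mono fun ω hω => ?_
  have hn' : (0 : ℝ) < n := Nat.cast_pos.2 hn
  have h1 : ∑ t : Fin n, f (ω t) ≤ n * a := hω
  rw [Fin.sum_univ_eq_sum_range (fun i => f (ω i))] at h1
  have h2 : (n : ℝ)⁻¹ * ∑ i ∈ Finset.range n, f (ω i) ≤ a := by
    rw [inv_mul_le_iff₀ hn']
    exact h1
  change _ ≤ edist _ _
  rw [edist_dist, Real.dist_eq, smul_eq_mul]
  refine ENNReal.ofReal_le_ofReal ?_
  rw [abs_sub_comm]
  exact (by linarith : _ ≤ _ - _).trans (le_abs_self _)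

lemma lintegral_infoDensity {𝒳 𝒴 : Type*} [Countable 𝒳] [Countable 𝒴]
    [MeasurableSpace 𝒳] [MeasurableSpace 𝒴] [DiscreteMeasurableSpace 𝒳]
    [DiscreteMeasurableSpace 𝒴] (Q : PMF (𝒳 × 𝒴)) :
    ∫⁻ p, ENNReal.ofReal (infoDensity Q p) ∂Q.toMeasure = condEntropy Q := by
  rw [lintegral_countable', condEntropy]
  refine tsum_congr fun p => ?_
  rw [PMF.toMeasure_apply_singleton _ _ (measurableSet_singleton p),
    ENNReal.ofReal_mul ENNReal.toReal_nonneg, ENNReal.ofReal_toReal (Q.apply_ne_top p), mul_comm]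
  rfl

/-- Below the entropy: the conditional probability of the emitted word is rarely larger than
`exp (-n h)` if `h < H(X|Y)`. As `H(X|Y)` may be infinite, the law of large numbers is applied to
the information density truncated at a high level. -/
lemma tendsto_exp_lt_condProb {𝒳 𝒴 : Type*} [Countable 𝒳] [Countable 𝒴] (Q : PMF (𝒳 × 𝒴))
    {h : ℝ} (hh : ENNReal.ofReal h < condEntropy Q) :
    Tendsto (fun n : ℕ => (iid Q n).toOuterMeasure
      {p | ENNReal.ofReal (Real.exp (-(n * h))) < condProb (iid Q n) p.1 p.2}) atTop (𝓝 0) := by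
  let _ : MeasurableSpace 𝒳 := ⊤
  let _ : MeasurableSpace 𝒴 := ⊤
  have hm (K : ℕ) : Measurable fun p => min (infoDensity Q p) (K : ℝ) := measurable_of_countable _
  have h0 (K : ℕ) (p : 𝒳 × 𝒴) : 0 ≤ min (infoDensity Q p) (K : ℝ) :=
    le_min (infoDensity_nonneg Q p) K.cast_nonneg
  have hsup : ⨆ K : ℕ, ∫⁻ p, ENNReal.ofReal (min (infoDensity Q p) K) ∂Q.toMeasure =
      condEntropy Q := by
    rw [← lintegral_infoDensity, ← lintegral_iSup (fun K => (hm K).ennreal_ofReal)]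
    · refine lintegral_congr fun p => le_antisymm
        (iSup_le fun K => ENNReal.ofReal_le_ofReal (min_le_left _ _)) ?_
      obtain ⟨K, hK⟩ := exists_nat_ge (infoDensity Q p)
      refine le_iSup_of_le K ?_
      rw [min_eq_left hK]
    · intro K L hKL p
      have : (K : ℝ) ≤ L := Nat.cast_le.2 hKL
      exact ENNReal.ofReal_le_ofReal (min_le_min_left _ this)
  rw [← hsup, lt_iSup_iff] at hh
  obtain ⟨K, hK⟩ := hh
  have hint : Integrable (fun p => min (infoDensity Q p) (K : ℝ)) Q.toMeasure :=
    Integrable.of_bound (hm K).aestronglyMeasurable (K : ℝ) (Eventually.of_forall fun p => by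
      rw [Real.norm_of_nonneg (h0 K p)]
      exact min_le_right _ _)
  rw [← ofReal_integral_eq_lintegral_ofReal hint (Eventually.of_forall (h0 K))] at hK
  have hK' : h < ∫ p, min (infoDensity Q p) (K : ℝ) ∂Q.toMeasure :=
    lt_of_not_ge fun hle => hK.not_ge (ENNReal.ofReal_le_ofReal hle)
  refine tendsto_of_tendsto_of_tendsto_of_le_of_le tendsto_const_nhds
    (tendsto_iid_sum_le Q _ hint hK') (fun _ => bot_le) fun n =>
      PMF.toOuterMeasure_mono _ ?_
  rintro p ⟨hp, hsupp⟩
  rw [Set.mem_ofPred_eq, condProb_iid_eq_exp ((PMF.mem_support_iff _ _).1 hsupp),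
    ENNReal.ofReal_lt_ofReal_iff (Real.exp_pos _), Real.exp_lt_exp, neg_lt_neg_iff] at hp
  exact (Finset.sum_le_sum fun t _ => min_le_left _ _).trans hp.le

/-- Above the entropy: the conditional probability of the emitted word is rarely smaller than
`exp (-n h)` if `h > H(X|Y)`. -/
lemma tendsto_condProb_lt_exp {𝒳 𝒴 : Type*} [Countable 𝒳] [Countable 𝒴] (Q : PMF (𝒳 × 𝒴))
    {h : ℝ} (hh : condEntropy Q < ENNReal.ofReal h) :
    Tendsto (fun n : ℕ => (iid Q n).toOuterMeasure
      {p | condProb (iid Q n) p.1 p.2 < ENNReal.ofReal (Real.exp (-(n * h)))}) atTop (𝓝 0) := by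
  let _ : MeasurableSpace 𝒳 := ⊤
  let _ : MeasurableSpace 𝒴 := ⊤
  have hint : Integrable (infoDensity Q) Q.toMeasure := by
    refine ⟨(measurable_of_countable _).aestronglyMeasurable, ?_⟩
    rw [hasFiniteIntegral_iff_ofReal (Eventually.of_forall (infoDensity_nonneg Q)),
      lintegral_infoDensity]
    exact hh.trans ENNReal.ofReal_lt_top
  rw [← lintegral_infoDensity, ← ofReal_integral_eq_lintegral_ofReal hint
    (Eventually.of_forall (infoDensity_nonneg Q))] at hh
  have hh' : -h < ∫ p, -infoDensity Q p ∂Q.toMeasure := by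
    rw [integral_neg, neg_lt_neg_iff]
    exact lt_of_not_ge fun hle => hh.not_ge (ENNReal.ofReal_le_ofReal hle)
  refine tendsto_of_tendsto_of_tendsto_of_le_of_le tendsto_const_nhds
    (tendsto_iid_sum_le Q _ hint.neg hh') (fun _ => bot_le) fun n =>
      PMF.toOuterMeasure_mono _ ?_
  rintro p ⟨hp, hsupp⟩
  rw [Set.mem_ofPred_eq, condProb_iid_eq_exp ((PMF.mem_support_iff _ _).1 hsupp),
    ENNReal.ofReal_lt_ofReal_iff (Real.exp_pos _), Real.exp_lt_exp, neg_lt_neg_iff] at hp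
  simp only [Set.mem_ofPred_eq, Pi.neg_apply, Finset.sum_neg_distrib]
  linarith

/-! ### Bounds for a single code -/

lemma tsum_codebook {𝒳 𝒴 : Type*} (C : Code 𝒳 𝒴) (x : 𝒳) (y : 𝒴) :
    ∑' c : codebook (C.enc y), C.enc y x c = 1 := by
  rw [tsum_subtype_eq_of_support_subset (f := C.enc y x), PMF.tsum_coe]
  exact fun c hc => ⟨x, hc⟩

/-- The probability that the pair `(x, y)` is decoded incorrectly, as a sum over all codewords. -/
lemma tsum_error_eq {𝒳 𝒴 : Type*} (C : Code 𝒳 𝒴) (x : 𝒳) (y : 𝒴) :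
    ∑' c : {c : codebook (C.enc y) // x ≠ C.dec y c}, C.enc y x (c.1 : List Bool) =
      ∑' c : codebook (C.enc y), {c | x ≠ C.dec y c}.indicator (fun c => C.enc y x c) c :=
  tsum_subtype {c | x ≠ C.dec y c} fun c : codebook (C.enc y) => C.enc y x c

lemma errorProb_le_one {𝒳 𝒴 : Type*} (C : Code 𝒳 𝒴) (P : PMF (𝒳 × 𝒴)) : C.errorProb P ≤ 1 := by
  rw [← P.tsum_coe]
  refine ENNReal.tsum_le_tsum fun p => mul_le_of_le_one_right' ?_
  rw [tsum_error_eq, ← tsum_codebook C p.1 p.2]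
  exact ENNReal.tsum_le_tsum fun c => Set.indicator_le_self _ _ c

lemma one_le_expMoment {𝒳 𝒴 : Type*} (C : Code 𝒳 𝒴) {ρ : ℝ} (hρ : 0 ≤ ρ) (P : PMF (𝒳 × 𝒴)) :
    1 ≤ C.expMoment ρ P := by
  rw [← P.tsum_coe]
  refine ENNReal.tsum_le_tsum fun p => le_mul_of_one_le_right' ?_
  rw [← tsum_codebook C p.1 p.2]
  refine ENNReal.tsum_le_tsum fun c => le_mul_of_one_le_right' ?_
  rw [← ENNReal.ofReal_one]
  exact ENNReal.ofReal_le_ofReal (Real.one_le_exp (by positivity))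

lemma exists_finset_length_lt (K : ℕ) :
    ∃ s : Finset (List Bool), (∀ c : List Bool, c.length < K → c ∈ s) ∧ s.card + 1 ≤ 2 ^ K := by
  induction K with
  | zero => exact ⟨∅, by simp⟩
  | succ K ih =>
    obtain ⟨s, hs, hcard⟩ := ih
    refine ⟨insert [] (s.image (List.cons true) ∪ s.image (List.cons false)), ?_, ?_⟩
    · rintro (_ | ⟨b, c⟩) hc
      · simp
      · have := hs c (by simpa using hc)
        cases b <;> simp [this]
    · have h1 := Finset.card_insert_le ([] : List Bool)
        (s.image (List.cons true) ∪ s.image (List.cons false))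
      have h2 := Finset.card_union_le (s.image (List.cons true)) (s.image (List.cons false))
      have h3 := Finset.card_image_le (s := s) (f := List.cons true)
      have h4 := Finset.card_image_le (s := s) (f := List.cons false)
      rw [pow_succ]
      omega

lemma tsum_length_lt_le {B : Set (List Bool)} (K : ℕ) :
    ∑' c : B, {c : B | c.1.length < K}.indicator (fun _ => (1 : ℝ≥0∞)) c ≤ 2 ^ K := by
  obtain ⟨s, hs, hcard⟩ := exists_finset_length_lt K
  calc ∑' c : B, {c : B | c.1.length < K}.indicator (fun _ => (1 : ℝ≥0∞)) c
      ≤ ∑' c : B, (s : Set (List Bool)).indicator (fun _ => (1 : ℝ≥0∞)) (c : List Bool) := by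
        refine ENNReal.tsum_le_tsum fun c => ?_
        by_cases h : c.1.length < K
        · simp [h, hs c.1 h]
        · simp [h]
    _ ≤ ∑' c : List Bool, (s : Set (List Bool)).indicator (fun _ => (1 : ℝ≥0∞)) c :=
        ENNReal.tsum_comp_le_tsum_of_injective Subtype.val_injective _
    _ = s.card := by rw [← tsum_subtype]; simp
    _ ≤ 2 ^ K := by exact_mod_cast (Nat.le_succ _).trans hcard

/-- A code cannot do well on words of small conditional probability: there are at most `2 ^ K`
codewords shorter than `K`, each of which is decoded to a single word, so the correctly decoded words
with conditional probability at most `r` and a codeword shorter than `K` have probability at most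
`r * 2 ^ K`. Codewords of length at least `K` are charged to the exponential moment by Markov's
inequality. -/
lemma one_le_errorProb_add {𝒳 𝒴 : Type*} (C : Code 𝒳 𝒴) (P : PMF (𝒳 × 𝒴)) {ρ : ℝ} (hρ : 0 ≤ ρ)
    (r : ℝ≥0∞) (K : ℕ) :
    1 ≤ C.errorProb P + P.toOuterMeasure {p | r < condProb P p.1 p.2} + r * 2 ^ K +
      ENNReal.ofReal (Real.exp (-(ρ * (K * Real.log 2)))) * C.expMoment ρ P := by
  classical
  let short (p : 𝒳 × 𝒴) : ℝ≥0∞ := ∑' c : codebook (C.enc p.2),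
    {c | C.dec p.2 c = p.1 ∧ c.1.length < K ∧ condProb P p.1 p.2 ≤ r}.indicator
      (fun c => C.enc p.2 p.1 c) c
  -- Bounding `P (x, y)` by `r * P_Y y` leaves, for each `y`, a count of pairs of a short codeword
  -- and the word it is decoded to.
  have hshort : ∑' p, P p * short p ≤ r * 2 ^ K := by
    calc ∑' p, P p * short p
        ≤ ∑' p : 𝒳 × 𝒴, margSnd P p.2 * ∑' c : codebook (C.enc p.2),
            r * {c | C.dec p.2 c = p.1 ∧ c.1.length < K}.indicator (fun _ => (1 : ℝ≥0∞)) c := by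
          refine ENNReal.tsum_le_tsum fun p => ?_
          rw [← condProb_mul_margSnd, mul_comm (condProb _ _ _), mul_assoc]
          gcongr
          rw [← ENNReal.tsum_mul_left]
          refine ENNReal.tsum_le_tsum fun c => ?_
          by_cases h : C.dec p.2 c = p.1 ∧ c.1.length < K ∧ condProb P p.1 p.2 ≤ r
          · simpa [h] using mul_le_mul' h.2.2 (PMF.coe_le_one (C.enc p.2 p.1) c)
          · rw [Set.indicator_of_notMem (by exact h)]
            simp
      _ = ∑' y, margSnd P y * (r * ∑' c : codebook (C.enc y), ∑' x,
            {c | C.dec y c = x ∧ c.1.length < K}.indicator (fun _ => (1 : ℝ≥0∞)) c) := by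
          rw [ENNReal.tsum_prod', ENNReal.tsum_comm]
          refine tsum_congr fun y => ?_
          simp only
          rw [ENNReal.tsum_mul_left, ENNReal.tsum_comm]
          simp only [ENNReal.tsum_mul_left]
      _ ≤ ∑' y, margSnd P y * (r * 2 ^ K) := by
          refine ENNReal.tsum_le_tsum fun y => ?_
          gcongr
          refine le_trans (ENNReal.tsum_le_tsum fun c => ?_) (tsum_length_lt_le K)
          rw [tsum_eq_single (C.dec y c)]
          · simp [Set.indicator_apply]
          · intro x hx
            simp [Ne.symm hx]
      _ = r * 2 ^ K := by rw [ENNReal.tsum_mul_right, tsum_margSnd, one_mul]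
  have key (p : 𝒳 × 𝒴) : P p ≤ P p * (∑' c : {c : codebook (C.enc p.2) // p.1 ≠ C.dec p.2 c},
        C.enc p.2 p.1 (c.1 : List Bool)) +
      {p | r < condProb P p.1 p.2}.indicator P p + P p * short p +
      ENNReal.ofReal (Real.exp (-(ρ * (K * Real.log 2)))) *
        (P p * ∑' c : codebook (C.enc p.2), C.enc p.2 p.1 (c : List Bool) *
          ENNReal.ofReal (Real.exp (ρ * ((c : List Bool).length * Real.log 2)))) := by
    have hind : {p | r < condProb P p.1 p.2}.indicator P p =
        P p * ∑' c : codebook (C.enc p.2), C.enc p.2 p.1 c *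
          (if r < condProb P p.1 p.2 then 1 else 0) := by
      rw [ENNReal.tsum_mul_right, tsum_codebook, one_mul]
      simp [Set.indicator_apply]
    rw [hind, tsum_error_eq, mul_left_comm, ← mul_add, ← mul_add, ← mul_add]
    refine le_mul_of_one_le_right' ?_
    simp only [short]
    rw [← ENNReal.tsum_mul_left, ← ENNReal.tsum_add, ← ENNReal.tsum_add, ← ENNReal.tsum_add]
    refine (tsum_codebook C p.1 p.2).symm.le.trans ?_
    refine ENNReal.tsum_le_tsum fun c => ?_
    -- For every codeword, one of the four terms is at least its probability.
    by_cases h1 : p.1 = C.dec p.2 c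
    swap
    · refine le_add_right (le_add_right (le_add_right ?_))
      rw [Set.indicator_of_mem (by exact h1)]
    by_cases h2 : r < condProb P p.1 p.2
    · refine le_add_right (le_add_right (le_add_left ?_))
      simp [h2]
    by_cases h3 : c.1.length < K
    · refine le_add_right (le_add_left ?_)
      rw [Set.indicator_of_mem (by exact ⟨h1.symm, h3, not_lt.1 h2⟩)]
    · refine le_add_left ?_
      rw [mul_left_comm]
      refine le_mul_of_one_le_right' ?_
      rw [← ENNReal.ofReal_mul (Real.exp_pos _).le, ← Real.exp_add, ← ENNReal.ofReal_one]
      refine ENNReal.ofReal_le_ofReal (Real.one_le_exp ?_)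
      have : (K : ℝ) ≤ c.1.length := Nat.cast_le.2 (not_lt.1 h3)
      have h4 := mul_le_mul_of_nonneg_left
        (mul_le_mul_of_nonneg_right this (Real.log_nonneg one_le_two)) hρ
      linarith
  calc 1 = ∑' p, P p := P.tsum_coe.symm
    _ ≤ _ := ENNReal.tsum_le_tsum key
    _ = C.errorProb P + P.toOuterMeasure {p | r < condProb P p.1 p.2} + ∑' p, P p * short p +
        ENNReal.ofReal (Real.exp (-(ρ * (K * Real.log 2)))) * C.expMoment ρ P := by
      rw [ENNReal.tsum_add, ENNReal.tsum_add, ENNReal.tsum_add, ENNReal.tsum_mul_left,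
        PMF.toOuterMeasure_apply]
      rfl
    _ ≤ _ := by gcongr

/-- Fixed-length coding: if every `S y` has at most `2 ^ L` elements, its elements can be encoded
injectively into strings of length `L`, so that errors only occur outside of `S y`. -/
lemma exists_code {𝒳 𝒴 : Type*} [Nonempty 𝒳] (S : 𝒴 → Finset 𝒳) (L : ℕ)
    (hS : ∀ y, (S y).card ≤ 2 ^ L) :
    ∃ C : Code 𝒳 𝒴, ∀ P : PMF (𝒳 × 𝒴),
      C.errorProb P ≤ P.toOuterMeasure {p | p.1 ∉ S p.2} ∧
      ∀ ρ : ℝ, C.expMoment ρ P = ENNReal.ofReal (Real.exp (ρ * (L * Real.log 2))) := by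
  classical
  have hg (y : 𝒴) : ∃ g : 𝒳 → (Fin L → Bool), Set.InjOn g (S y) := by
    obtain ⟨g, -, hg⟩ := (S y).finite_toSet.exists_injOn_of_encard_le
      (t := (Set.univ : Set (Fin L → Bool))) (by
        rw [Set.encard_coe_eq_coe_finsetCard, Set.encard_univ, ENat.card_eq_coe_fintype_card]
        have := hS y
        simp only [Fintype.card_pi, Fintype.card_bool, Finset.prod_const, Finset.card_univ,
          Fintype.card_fin]
        exact_mod_cast this)
    exact ⟨g, hg⟩
  choose g hg using hg
  let w (y : 𝒴) (x : 𝒳) : List Bool := List.ofFn (g y x)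
  have hw (y : 𝒴) : Set.InjOn (w y) (S y) := fun a ha b hb hab =>
    hg y ha hb (List.ofFn_injective hab)
  have hlen (y : 𝒴) : ∀ c ∈ codebook (fun x => PMF.pure (w y x)), c.length = L := by
    rintro c ⟨x, hx⟩
    rw [PMF.mem_support_pure_iff] at hx
    simp [hx, w]
  let C : Code 𝒳 𝒴 := ⟨fun y x => PMF.pure (w y x),
    fun y c => Function.invFunOn (w y) (S y) c.1,
    fun y c hc c' hc' hp => hp.eq_of_length ((hlen y c hc).trans (hlen y c' hc').symm)⟩
  refine ⟨C, fun P => ?_⟩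
  constructor
  · rw [PMF.toOuterMeasure_apply]
    refine ENNReal.tsum_le_tsum fun p => ?_
    by_cases hp : p.1 ∈ S p.2
    · refine le_of_eq_of_le ?_ bot_le
      refine mul_eq_zero_of_right _ (ENNReal.tsum_eq_zero.2 ?_)
      rintro ⟨c, hc⟩
      refine PMF.pure_apply_of_ne _ _ fun hcw => hc ?_
      change p.1 = Function.invFunOn (w p.2) (S p.2) c.1
      rw [hcw]
      exact ((hw p.2).leftInvOn_invFunOn hp).symm
    · rw [Set.indicator_of_mem (by exact hp)]
      refine mul_le_of_le_one_right' ?_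
      exact (ENNReal.tsum_comp_le_tsum_of_injective
        (Subtype.val_injective.comp Subtype.val_injective) _).trans (PMF.tsum_coe _).le
  · intro ρ
    rw [← one_mul (ENNReal.ofReal _), ← P.tsum_coe, ← ENNReal.tsum_mul_right]
    refine tsum_congr fun p => ?_
    congr 1
    rw [← one_mul (ENNReal.ofReal _), ← tsum_codebook C p.1 p.2, ← ENNReal.tsum_mul_right]
    refine tsum_congr fun c => ?_
    rw [hlen p.2 c.1 c.2]

/-! ### Mixtures -/

lemma IsMixture.tsum_mul {𝒳 𝒴 : Type*} {P : GeneralSource 𝒳 𝒴} {m : ℕ} {Q : Fin m → PMF (𝒳 × 𝒴)}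
    {α : Fin m → ℝ} (hmix : IsMixture P Q α) {n : ℕ} (hn : 1 ≤ n)
    (F : (Fin n → 𝒳) × (Fin n → 𝒴) → ℝ≥0∞) :
    ∑' p, P n p * F p = ∑ j, ENNReal.ofReal (α j) * ∑' p, iid (Q j) n p * F p := by
  simp_rw [← ENNReal.tsum_mul_left]
  rw [← Summable.tsum_finsetSum fun _ _ => ENNReal.summable]
  refine tsum_congr fun p => ?_
  rw [← Prod.mk.eta (p := p), hmix.apply_eq n hn, Finset.sum_mul]
  simp only [iid_apply, mul_assoc]

lemma IsMixture.errorProb_eq {𝒳 𝒴 : Type*} {P : GeneralSource 𝒳 𝒴} {m : ℕ}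
    {Q : Fin m → PMF (𝒳 × 𝒴)} {α : Fin m → ℝ} (hmix : IsMixture P Q α) {n : ℕ} (hn : 1 ≤ n)
    (C : Code (Fin n → 𝒳) (Fin n → 𝒴)) :
    C.errorProb (P n) = ∑ j, ENNReal.ofReal (α j) * C.errorProb (iid (Q j) n) :=
  hmix.tsum_mul hn _

lemma IsMixture.expMoment_eq {𝒳 𝒴 : Type*} {P : GeneralSource 𝒳 𝒴} {m : ℕ}
    {Q : Fin m → PMF (𝒳 × 𝒴)} {α : Fin m → ℝ} (hmix : IsMixture P Q α) {n : ℕ} (hn : 1 ≤ n)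
    (C : Code (Fin n → 𝒳) (Fin n → 𝒴)) (ρ : ℝ) :
    C.expMoment ρ (P n) = ∑ j, ENNReal.ofReal (α j) * C.expMoment ρ (iid (Q j) n) :=
  hmix.tsum_mul hn _

lemma IsMixture.ofReal_cumWeight {𝒳 𝒴 : Type*} {P : GeneralSource 𝒳 𝒴} {m : ℕ}
    {Q : Fin m → PMF (𝒳 × 𝒴)} {α : Fin m → ℝ} (hmix : IsMixture P Q α) (k : ℕ) :
    ENNReal.ofReal (cumWeight α k) = ∑ j : Fin m with j.val < k, ENNReal.ofReal (α j) :=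
  ENNReal.ofReal_sum_of_nonneg fun j _ => (hmix.weight_pos j).le

lemma tendsto_ofReal_two_mul_exp {c : ℝ} (hc : 0 < c) :
    Tendsto (fun n : ℕ => ENNReal.ofReal (2 * Real.exp (-(n * c)))) atTop (𝓝 0) := by
  rw [← ENNReal.ofReal_zero]
  refine ENNReal.tendsto_ofReal ?_
  rw [← mul_zero (2 : ℝ)]
  refine Tendsto.const_mul 2 (Real.tendsto_exp_neg_atTop_nhds_zero.comp ?_)
  exact tendsto_natCast_atTop_atTop.atTop_mul_const hc

/-! ### Converse -/

/-- The strong converse for the mixture. The single-code bound for the memoryless components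
`j < k` at threshold `exp (-n h')` and length `n h / log 2` is averaged with the weights `α j`: as
their total weight `cumWeight α k` exceeds `ε`, the exponential moment must be at least a constant
times `exp (ρ n h)`. The gap between `h` and `h'` makes the number of short codewords negligible
compared with `exp (n h')`. -/
lemma IsMixture.mul_le_of_isAchievable {𝒳 𝒴 : Type*} [Countable 𝒳] [Countable 𝒴]
    {P : GeneralSource 𝒳 𝒴} {m : ℕ} {Q : Fin m → PMF (𝒳 × 𝒴)} {α : Fin m → ℝ}
    (hmix : IsMixture P Q α) {ρ ε R : ℝ} (hρ : 0 ≤ ρ) (hε : 0 ≤ ε) {k : ℕ}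
    (hk : ε < cumWeight α k) {h h' : ℝ} (h0 : 0 ≤ h) (hh : h < h')
    (hH : ∀ j : Fin m, j.val < k → ENNReal.ofReal h' < condEntropy (Q j))
    (hR : IsAchievable P ρ ε R) : ρ * h ≤ R := by
  obtain ⟨C, hpe, hM⟩ := hR
  -- The slack is shared between the error probability, the vanishing terms and the moment term.
  obtain ⟨δ, hδ, hδε⟩ : ∃ δ > 0, ε + 3 * δ = cumWeight α k :=
    ⟨(cumWeight α k - ε) / 3, by linarith, by ring⟩
  let tail (j : Fin m) (n : ℕ) : ℝ≥0∞ := (iid (Q j) n).toOuterMeasure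
      {p | ENNReal.ofReal (Real.exp (-(n * h'))) < condProb (iid (Q j) n) p.1 p.2} +
    ENNReal.ofReal (2 * Real.exp (-(n * (h' - h))))
  let T (n : ℕ) : ℝ≥0∞ := ∑ j : Fin m with j.val < k, ENNReal.ofReal (α j) * tail j n
  have hT : Tendsto T atTop (𝓝 0) := by
    rw [← Finset.sum_const_zero (s := Finset.univ.filter fun j : Fin m => j.val < k)]
    refine tendsto_finsetSum _ fun j hj => ?_
    rw [← mul_zero (ENNReal.ofReal (α j))]
    refine ENNReal.Tendsto.const_mul ?_ (Or.inr ENNReal.ofReal_ne_top)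
    rw [← add_zero (0 : ℝ≥0∞)]
    exact (tendsto_exp_lt_condProb (Q j) (hH j (Finset.mem_filter.1 hj).2)).add
      (tendsto_ofReal_two_mul_exp (sub_pos.2 hh))
  have hlog2 : 0 < Real.log 2 := Real.log_pos one_lt_two
  have bound (n : ℕ) (hn : 1 ≤ n) : ENNReal.ofReal (cumWeight α k) ≤
      (C n).errorProb (P n) + T n +
        ENNReal.ofReal (Real.exp (-(ρ * (n * h)))) * (C n).expMoment ρ (P n) := by
    have hnh : 0 ≤ n * h := by positivity
    set K : ℕ := ⌈n * h / Real.log 2⌉₊ with hK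
    have hK1 : n * h ≤ K * Real.log 2 := (div_le_iff₀ hlog2).1 (Nat.le_ceil _)
    have hK2 : K * Real.log 2 ≤ n * h + Real.log 2 := by
      have := (Nat.ceil_lt_add_one (div_nonneg hnh hlog2.le)).le
      rw [← hK, ← div_self hlog2.ne', ← add_div, le_div_iff₀ hlog2] at this
      exact this
    have hpow : ENNReal.ofReal (Real.exp (-(n * h'))) * 2 ^ K ≤
        ENNReal.ofReal (2 * Real.exp (-(n * (h' - h)))) := by
      have : (2 : ℝ≥0∞) ^ K = ENNReal.ofReal (Real.exp (K * Real.log 2)) := by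
        rw [Real.exp_nat_mul, Real.exp_log two_pos, ENNReal.ofReal_pow zero_le_two]
        simp
      rw [this, ← ENNReal.ofReal_mul (Real.exp_pos _).le, ← Real.exp_add]
      refine ENNReal.ofReal_le_ofReal ?_
      nth_rewrite 2 [← Real.exp_log two_pos]
      rw [← Real.exp_add]
      exact Real.exp_le_exp.2 (by linarith)
    have hexp : ENNReal.ofReal (Real.exp (-(ρ * (K * Real.log 2)))) ≤
        ENNReal.ofReal (Real.exp (-(ρ * (n * h)))) :=
      ENNReal.ofReal_le_ofReal (Real.exp_le_exp.2 (neg_le_neg (mul_le_mul_of_nonneg_left hK1 hρ)))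
    have single (j : Fin m) : 1 ≤ (C n).errorProb (iid (Q j) n) + tail j n +
        ENNReal.ofReal (Real.exp (-(ρ * (n * h)))) * (C n).expMoment ρ (iid (Q j) n) := by
      refine (one_le_errorProb_add (C n) (iid (Q j) n) hρ
        (ENNReal.ofReal (Real.exp (-(n * h')))) K).trans ?_
      simp only [tail]
      rw [← add_assoc]
      gcongr
    calc ENNReal.ofReal (cumWeight α k)
        = ∑ j : Fin m with j.val < k, ENNReal.ofReal (α j) * 1 := by
          simp only [mul_one, hmix.ofReal_cumWeight]
      _ ≤ ∑ j : Fin m with j.val < k, ENNReal.ofReal (α j) *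
          ((C n).errorProb (iid (Q j) n) + tail j n +
            ENNReal.ofReal (Real.exp (-(ρ * (n * h)))) * (C n).expMoment ρ (iid (Q j) n)) :=
          Finset.sum_le_sum fun j _ => mul_le_mul_right (single j) _
      _ = ∑ j : Fin m with j.val < k, ENNReal.ofReal (α j) * (C n).errorProb (iid (Q j) n) + T n +
          ENNReal.ofReal (Real.exp (-(ρ * (n * h)))) * ∑ j : Fin m with j.val < k,
            ENNReal.ofReal (α j) * (C n).expMoment ρ (iid (Q j) n) := by
          simp only [mul_add, Finset.sum_add_distrib, Finset.mul_sum, T]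
          congr 2
          ext j
          rw [mul_left_comm]
      _ ≤ _ := by
          rw [hmix.errorProb_eq hn, hmix.expMoment_eq hn]
          gcongr <;> exact Finset.filter_subset _ _
  have hev : ∀ᶠ n : ℕ in atTop, ((Real.log δ / n + ρ * h : ℝ) : EReal) ≤
      ENNReal.log ((C n).expMoment ρ (P n)) / (n : EReal) := by
    have hpe' : limsup (fun n => (C n).errorProb (P n)) atTop < ENNReal.ofReal (ε + δ) :=
      hpe.trans_lt ((ENNReal.ofReal_lt_ofReal_iff_of_nonneg hε).2 (by linarith))
    filter_upwards [eventually_lt_of_limsup_lt hpe',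
      hT.eventually_lt_const (ENNReal.ofReal_pos.2 hδ), eventually_ge_atTop 1] with n h1 h2 hn
    have h3 : ENNReal.ofReal δ ≤
        ENNReal.ofReal (Real.exp (-(ρ * (n * h)))) * (C n).expMoment ρ (P n) := by
      by_contra! hlt
      refine (bound n hn).not_gt ((ENNReal.add_lt_add (ENNReal.add_lt_add h1 h2) hlt).trans_eq ?_)
      rw [← ENNReal.ofReal_add (by positivity) hδ.le, ← ENNReal.ofReal_add (by positivity) hδ.le,
        ← hδε]
      ring_nf
    have h4 : ENNReal.ofReal (δ * Real.exp (ρ * (n * h))) ≤ (C n).expMoment ρ (P n) := by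
      rw [mul_comm, ENNReal.ofReal_mul (Real.exp_pos _).le]
      refine (mul_le_mul_right h3 _).trans_eq ?_
      rw [← mul_assoc, ← ENNReal.ofReal_mul (Real.exp_pos _).le, ← Real.exp_add]
      simp
    have hn0 : (n : ℝ) ≠ 0 := by positivity
    have h5 : Real.log δ / n + ρ * h = Real.log (δ * Real.exp (ρ * (n * h))) / n := by
      rw [Real.log_mul hδ.ne' (Real.exp_pos _).ne', Real.log_exp]
      field_simp
    rw [h5, EReal.coe_div, ← ENNReal.log_ofReal_of_pos (by positivity)]
    exact EReal.div_le_div_right_of_nonneg (Nat.cast_nonneg' n) (ENNReal.log_le_log h4)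
  -- The constant factor `δ` disappears in the exponent.
  have hlim : Tendsto (fun n : ℕ => ((Real.log δ / n + ρ * h : ℝ) : EReal)) atTop
      (𝓝 ((ρ * h : ℝ) : EReal)) := by
    refine EReal.tendsto_coe.2 ?_
    simpa using (tendsto_const_div_atTop_nhds_zero_nat (Real.log δ)).add_const (ρ * h)
  rw [← EReal.coe_le_coe_iff, ← hlim.limsup_eq]
  exact (limsup_le_limsup hev).trans hM

/-- This is the converse in the case of zero entropy, where no rate `h ≥ 0` lies below the
entropy. -/
lemma nonneg_of_isAchievable {𝒳 𝒴 : Type*} {P : GeneralSource 𝒳 𝒴} {ρ ε R : ℝ} (hρ : 0 ≤ ρ)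
    (hR : IsAchievable P ρ ε R) : 0 ≤ R := by
  obtain ⟨C, -, hM⟩ := hR
  rw [← EReal.coe_nonneg]
  refine le_trans ?_ hM
  refine le_limsup_of_frequently_le (Frequently.of_forall fun n => ?_)
  exact EReal.div_nonneg (ENNReal.zero_le_log_iff.2 (one_le_expMoment _ hρ _)) (Nat.cast_nonneg' n)

/-! ### Achievability -/

lemma exists_finset_le_condProb {𝒳 𝒴 : Type*} (P : PMF (𝒳 × 𝒴)) (y : 𝒴) (a : ℝ) :
    ∃ s : Finset 𝒳, (∀ x, ENNReal.ofReal (Real.exp (-a)) ≤ condProb P x y → x ∈ s) ∧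
      (s.card : ℝ) ≤ Real.exp a := by
  obtain ⟨hf, hcard⟩ := ENNReal.finset_card_const_le_le_of_tsum_le ENNReal.one_ne_top
    (tsum_condProb_le_one P y) (ENNReal.ofReal_pos.2 (Real.exp_pos (-a))).ne'
  refine ⟨hf.toFinset, fun x hx => by simpa using hx, ?_⟩
  generalize hf.toFinset.card = N at hcard ⊢
  rw [one_div, ← ENNReal.ofReal_inv_of_pos (Real.exp_pos _), Real.exp_neg, inv_inv,
    ← ENNReal.ofReal_natCast, ENNReal.ofReal_le_ofReal_iff (Real.exp_pos _).le] at hcard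
  exact hcard

/-- The direct part. Given `y`, the words whose conditional probability under some component is at
least `exp (-n h)` number at most `m * exp (n h)`, and are encoded with a fixed length. They carry
nearly all the mass of the components `j` with `k ≤ j`; the components `j < k` are given up, at the
cost of an error probability of `cumWeight α k`. -/
lemma IsMixture.isAchievable {𝒳 𝒴 : Type*} [Countable 𝒳] [Countable 𝒴]
    {P : GeneralSource 𝒳 𝒴} {m : ℕ} {Q : Fin m → PMF (𝒳 × 𝒴)} {α : Fin m → ℝ}
    (hmix : IsMixture P Q α) {ρ ε R : ℝ} (hρ : 0 ≤ ρ) {k : ℕ} (hm : 0 < m)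
    (hk : cumWeight α k ≤ ε) {h : ℝ} (h0 : 0 ≤ h)
    (hH : ∀ j : Fin m, k ≤ j.val → condEntropy (Q j) < ENNReal.ofReal h)
    (hR : ρ * h < R) : IsAchievable P ρ ε R := by
  classical
  have : Nonempty 𝒳 := ⟨(Q ⟨0, hm⟩).support_nonempty.some.1⟩
  have hm1 : (1 : ℝ) ≤ m := Nat.one_le_cast.2 hm
  have hlog2 : 0 < Real.log 2 := Real.log_pos one_lt_two
  have hlogm : 0 ≤ Real.log m := Real.log_nonneg hm1
  let L (n : ℕ) : ℕ := ⌈(Real.log m + n * h) / Real.log 2⌉₊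
  have hL1 (n : ℕ) : Real.log m + n * h ≤ L n * Real.log 2 :=
    (div_le_iff₀ hlog2).1 (Nat.le_ceil _)
  have hL2 (n : ℕ) : L n * Real.log 2 ≤ Real.log m + n * h + Real.log 2 := by
    have := (Nat.ceil_lt_add_one (a := (Real.log m + n * h) / Real.log 2) (by positivity)).le
    rwa [← div_self hlog2.ne', ← add_div, le_div_iff₀ hlog2] at this
  choose s hs hscard using fun (n : ℕ) (j : Fin m) (y : Fin n → 𝒴) =>
    exists_finset_le_condProb (iid (Q j) n) y (n * h)
  let S (n : ℕ) (y : Fin n → 𝒴) : Finset (Fin n → 𝒳) := Finset.univ.biUnion fun j => s n j y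
  have hS (n : ℕ) (y : Fin n → 𝒴) : (S n y).card ≤ 2 ^ L n := by
    have h1 : ((S n y).card : ℝ) ≤ m * Real.exp (n * h) := by
      calc ((S n y).card : ℝ) ≤ ∑ j, ((s n j y).card : ℝ) := mod_cast Finset.card_biUnion_le
        _ ≤ ∑ _j : Fin m, Real.exp (n * h) := Finset.sum_le_sum fun j _ => hscard n j y
        _ = _ := by simp
    have h2 : (m : ℝ) * Real.exp (n * h) ≤ 2 ^ L n := by
      calc (m : ℝ) * Real.exp (n * h) = Real.exp (Real.log m + n * h) := by
            rw [Real.exp_add, Real.exp_log (by positivity)]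
        _ ≤ Real.exp (L n * Real.log 2) := Real.exp_le_exp.2 (hL1 n)
        _ = 2 ^ L n := by rw [Real.exp_nat_mul, Real.exp_log two_pos]
    exact_mod_cast h1.trans h2
  choose C hCe hCM using fun n => exists_code (S n) (L n) (hS n)
  refine ⟨C, ?_, ?_⟩
  · let b (j : Fin m) (n : ℕ) : ℝ≥0∞ := if j.val < k then 1 else (iid (Q j) n).toOuterMeasure
      {p | condProb (iid (Q j) n) p.1 p.2 < ENNReal.ofReal (Real.exp (-(n * h)))}
    have hb (j : Fin m) (n : ℕ) : (C n).errorProb (iid (Q j) n) ≤ b j n := by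
      by_cases hj : j.val < k
      · simpa [b, hj] using errorProb_le_one _ _
      · simp only [b, hj, if_false]
        refine (hCe n _).trans (measure_mono fun p hp => ?_)
        by_contra hle
        exact hp (Finset.mem_biUnion.2 ⟨j, Finset.mem_univ j, hs n j p.2 p.1 (not_lt.1 hle)⟩)
    have hlim : Tendsto (fun n => ∑ j, ENNReal.ofReal (α j) * b j n) atTop
        (𝓝 (ENNReal.ofReal (cumWeight α k))) := by
      rw [hmix.ofReal_cumWeight, Finset.sum_filter]
      refine tendsto_finsetSum _ fun j _ => ?_
      by_cases hj : j.val < k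
      · simp [b, hj]
      · simp only [b, hj, if_false]
        rw [← mul_zero (ENNReal.ofReal (α j))]
        exact ENNReal.Tendsto.const_mul (tendsto_condProb_lt_exp (Q j) (hH j (not_lt.1 hj)))
          (Or.inr ENNReal.ofReal_ne_top)
    refine le_trans ?_ (ENNReal.ofReal_le_ofReal hk)
    rw [← hlim.limsup_eq]
    refine limsup_le_limsup ?_
    filter_upwards [eventually_ge_atTop 1] with n hn
    rw [hmix.errorProb_eq hn]
    exact Finset.sum_le_sum fun j _ => mul_le_mul_right (hb j n) _
  · have hlim : Tendsto (fun n : ℕ => ((ρ * (Real.log m + Real.log 2) / n + ρ * h : ℝ) : EReal))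
        atTop (𝓝 ((ρ * h : ℝ) : EReal)) := by
      refine EReal.tendsto_coe.2 ?_
      simpa using (tendsto_const_div_atTop_nhds_zero_nat (ρ * (Real.log m + Real.log 2))).add_const
        (ρ * h)
    refine le_trans ?_ (EReal.coe_le_coe_iff.2 hR.le)
    rw [← hlim.limsup_eq]
    refine limsup_le_limsup ?_
    filter_upwards [eventually_ge_atTop 1] with n hn
    have hn0 : (0 : ℝ) < n := by positivity
    rw [hCM, ENNReal.log_ofReal_of_pos (Real.exp_pos _), Real.log_exp]
    change ((_ : ℝ) : EReal) / (((n : ℝ)) : EReal) ≤ _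
    rw [← EReal.coe_div, EReal.coe_le_coe_iff, div_le_iff₀ hn0]
    have := mul_le_mul_of_nonneg_left (hL2 n) hρ
    have h3 : (ρ * (Real.log m + Real.log 2) / n + ρ * h) * n =
        ρ * (Real.log m + n * h + Real.log 2) := by
      field_simp
      ring
    rwa [h3]

/-! ### Cumulative weights -/

lemma cumWeight_mono {m : ℕ} {α : Fin m → ℝ} (hα : ∀ i, 0 ≤ α i) : Monotone (cumWeight α) :=
  fun _ _ hkl => Finset.sum_le_sum_of_subset_of_nonneg
    (Finset.monotone_filter_right _ fun _ _ h => lt_of_lt_of_le h hkl) fun i _ _ => hα i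

lemma existsUnique_mem_Ico_cumWeight {m : ℕ} {α : Fin m → ℝ} (hα : ∀ i, 0 ≤ α i)
    (hsum : ∑ i, α i = 1) {ε : ℝ} (hε0 : 0 ≤ ε) (hε1 : ε < 1) :
    ∃! i : Fin m, ε ∈ Set.Ico (cumWeight α i) (cumWeight α (i + 1)) := by
  classical
  have hm : ε < cumWeight α m := by simpa [cumWeight, hsum] using hε1
  have hex : ∃ k, ε < cumWeight α k := ⟨m, hm⟩
  obtain ⟨k, hk⟩ : ∃ k, Nat.find hex = k + 1 := by
    refine Nat.exists_eq_succ_of_ne_zero fun h0 => ?_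
    have := Nat.find_spec hex
    rw [h0] at this
    simp [cumWeight] at this
    linarith
  have hkm : k < m := by
    have := Nat.find_min' hex hm
    omega
  refine ⟨⟨k, hkm⟩, ⟨not_lt.1 (Nat.find_min hex (m := k) (by omega)), ?_⟩, ?_⟩
  · simpa only [hk] using Nat.find_spec hex
  · rintro ⟨l, hl⟩ ⟨h1, h2⟩
    have h3 : k + 1 ≤ l + 1 := hk ▸ Nat.find_min' hex h2
    have h4 : ¬ k + 1 ≤ l := fun hle => by
      have := hk ▸ Nat.find_spec hex
      exact (this.trans_le (cumWeight_mono hα hle)).not_ge h1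
    exact Fin.ext (by simp only; omega)

end MixedSource

theorem corollary3 {𝒳 𝒴 : Type*} [Countable 𝒳] [Countable 𝒴]
    (P : MixedSource.GeneralSource 𝒳 𝒴) {m : ℕ} (Q : Fin m → PMF (𝒳 × 𝒴)) (α : Fin m → ℝ)
    (hmix : MixedSource.IsMixture P Q α)
    (hH : StrictAnti fun i => MixedSource.condEntropy (Q i))
    (ρ : ℝ) (hρ : 0 < ρ) (ε : ℝ) (hε0 : 0 ≤ ε) (hε1 : ε < 1) :
    (∃! i : Fin m, ε ∈ Set.Ico (MixedSource.cumWeight α i) (MixedSource.cumWeight α (i + 1))) ∧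
    ∀ i : Fin m, ε ∈ Set.Ico (MixedSource.cumWeight α i) (MixedSource.cumWeight α (i + 1)) →
      MixedSource.optExponent P ρ ε =
        (ρ : EReal) * ((MixedSource.condEntropy (Q i) : ENNReal) : EReal) := by
  refine ⟨MixedSource.existsUnique_mem_Ico_cumWeight (fun i => (hmix.weight_pos i).le)
    hmix.weight_sum hε0 hε1, fun i hi => le_antisymm ?_ ?_⟩
  · -- If `H(X_i|Y_i) = ∞` there is nothing to achieve.
    by_cases htop : MixedSource.condEntropy (Q i) = ∞
    · rw [htop, EReal.coe_ennreal_top, EReal.coe_mul_top_of_pos hρ]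
      exact le_top
    lift MixedSource.condEntropy (Q i) to NNReal using htop with H hHi
    refine EReal.le_of_forall_lt_iff_le.1 fun R hR => sInf_le ⟨R, rfl, ?_⟩
    have hR' : (H : ℝ) < R / ρ := by
      rw [lt_div_iff₀' hρ]
      rw [← EReal.coe_lt_coe_iff, EReal.coe_mul]
      exact hR
    obtain ⟨h, hHh, hhR⟩ := exists_between hR'
    refine hmix.isAchievable hρ.le i.pos hi.1 (H.coe_nonneg.trans hHh.le) (fun j hj => ?_)
      ((lt_div_iff₀' hρ).1 hhR)
    refine (hH.antitone (show i ≤ j from hj)).trans_lt ?_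
    simp only [← hHi]
    rw [← ENNReal.ofReal_coe_nnreal]
    exact (ENNReal.ofReal_lt_ofReal_iff_of_nonneg H.coe_nonneg).2 hHh
  · refine le_sInf ?_
    rintro _ ⟨R, rfl, hR⟩
    have hR0 : 0 ≤ R := MixedSource.nonneg_of_isAchievable hρ.le hR
    have hle : MixedSource.condEntropy (Q i) ≤ ENNReal.ofReal (R / ρ) := by
      by_contra! hlt
      -- Rates `h < h'` strictly between `R / ρ` and the entropy.
      obtain ⟨h, h1, h2⟩ := exists_between hlt
      obtain ⟨h', h3, h4⟩ := exists_between h2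
      lift h to NNReal using (h2.trans_le le_top).ne
      lift h' to NNReal using (h4.trans_le le_top).ne
      have hρh : ρ * h ≤ R := hmix.mul_le_of_isAchievable hρ.le hε0 hi.2 h.coe_nonneg
        (h' := h') (mod_cast h3) (fun j hj => ?_) hR
      · rw [← ENNReal.ofReal_coe_nnreal] at h1
        have := (ENNReal.ofReal_lt_ofReal_iff_of_nonneg (by positivity)).1 h1
        rw [div_lt_iff₀' hρ] at this
        exact this.not_ge hρh
      · rw [ENNReal.ofReal_coe_nnreal]
        exact h4.trans_le (hH.antitone (show j ≤ i from Nat.lt_succ_iff.1 hj))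
    calc (ρ : EReal) * ((MixedSource.condEntropy (Q i) : ENNReal) : EReal)
        ≤ ρ * ((ENNReal.ofReal (R / ρ) : ENNReal) : EReal) :=
          mul_le_mul_of_nonneg_left (mod_cast hle) (mod_cast hρ.le)
      _ = R := by
          rw [EReal.coe_ennreal_ofReal, max_eq_left (by positivity), ← EReal.coe_mul,
            mul_div_cancel₀ _ hρ.ne']
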